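/- Identify $SU(2)$ with the group $S^3$ of unit quaternions, and let $\phi: SU(2)\times M\to M$, $(g,x)\mapsto gx$, be a smooth (left) action on a finite-dimensional smooth manifold $M$ without boundary. Let $U(\mathbb H^2)$ be the unit sphere of $\mathbb H^2$. Let $S^4$ be the quotient of $U(\mathbb H^2)$ by the relation $(v_1,v_2)\sim(v_1g,v_2g)$, $g\in SU(2)$, with points $[v_1:v_2]$, and let $P^0_\phi=U(\mathbb H^2)\times_{SU(2)}M$ be the quotient of $U(\mathbb H^2)\times M$ by the relation $((v_1g,v_2g),x)\sim((v_1,v_2),gx)$, $g\in SU(2)$. The projection $P^0_\phi\to S^4$, $[(v_1,v_2),x]\mapsto[v_1:v_2]$, is a fibre bundle with fibre $M$ (the bundle with clutching function $\phi$), and each $h\in SU(2)$ acts on $S^4$ and on $P^0_\phi$ by $$(h,[v_1:v_2])\mapsto[h^{-1}v_1:v_2],\qquad (h,[(v_1,v_2),x])\mapsto[(h^{-1}v_1,v_2),x].$$ 1. There is a continuous section $s:S^4\to P^0_\phi$ that is equivariant for these $SU(2)$-actions on $S^4$ and $P^0_\phi$ if and only if the $SU(2)$-action on $M$ has a fixed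 point. 2. Suppose moreover that $M$ is connected. If $s_1,s_2:S^4\to P^0_\phi$ are any two continuous sections (not necessarily equivariant), then for every fibre inclusion $\iota_v:M\to P^0_\phi$, $x\mapsto[v,x]$, with $v\in U(\mathbb H^2)$, and every base point $m\in M$, the class $(s_2)_*([S^4])-(s_1)_*([S^4])\in H_4(P^0_\phi;\mathbb Z)$ lies in the image of the composition $$\pi_4(M,m)\xrightarrow{(\iota_v)_*}\pi_4(P^0_\phi,\iota_v(m))\longrightarrow H_4(P^0_\phi;\mathbb Z)$$ of the map induced by the inclusion of the fibre with the Hurewicz map. -/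

import Mathlib

open scoped Quaternion Manifold ContDiff Topology unitInterval Simplicial

noncomputable section

namespace SU2Bundle

/-! ### The group, the unit sphere of the quaternion plane, and the bundle -/

/-- `SU(2)`, identified with the Lie group `S³` of unit quaternions. -/
abbrev SU2 : Type := Metric.sphere (0 : ℍ) 1

instance finrankQuaternion : Fact (Module.finrank ℝ ℍ = 3 + 1) :=
  ⟨Quaternion.finrank_eq_four⟩

/-- `U(ℍ²)`, the unit length vectors `(v₁, v₂)` of the quaternion plane. -/
def UnitH2 : Type := {v : ℍ × ℍ // ‖v.1‖ ^ 2 + ‖v.2‖ ^ 2 = 1}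

instance : TopologicalSpace UnitH2 :=
  inferInstanceAs (TopologicalSpace {v : ℍ × ℍ // ‖v.1‖ ^ 2 + ‖v.2‖ ^ 2 = 1})

theorem norm_su2 (g : SU2) : ‖(g : ℍ)‖ = 1 := mem_sphere_zero_iff_norm.1 g.2

/-- Right multiplication `(v₁, v₂) ↦ (v₁ g, v₂ g)`, written as the left action
`g • (v₁, v₂) = (v₁ g⁻¹, v₂ g⁻¹)`. -/
instance : MulAction SU2 UnitH2 where
  smul g v := ⟨(v.1.1 * ((g⁻¹ : SU2) : ℍ), v.1.2 * ((g⁻¹ : SU2) : ℍ)), by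
    simp only [norm_mul, norm_su2, mul_one]; exact v.2⟩
  one_smul v := by
    apply Subtype.ext
    change (v.1.1 * (((1 : SU2)⁻¹ : SU2) : ℍ), v.1.2 * (((1 : SU2)⁻¹ : SU2) : ℍ)) = v.1
    simp
  mul_smul g h v := by
    apply Subtype.ext
    change (v.1.1 * (((g * h)⁻¹ : SU2) : ℍ), v.1.2 * (((g * h)⁻¹ : SU2) : ℍ)) =
      ((v.1.1 * ((h⁻¹ : SU2) : ℍ)) * ((g⁻¹ : SU2) : ℍ),
        (v.1.2 * ((h⁻¹ : SU2) : ℍ)) * ((g⁻¹ : SU2) : ℍ))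
    rw [mul_inv_rev, Metric.unitSphere.coe_mul, mul_assoc, mul_assoc]

/-- The base `S⁴`: the orbit space of `U(ℍ²)`, with points `[v₁ : v₂]`. -/
abbrev S4 : Type := MulAction.orbitRel.Quotient SU2 UnitH2

/-- The total space `P⁰ = U(ℍ²) ×_{SU(2)} M`: the orbit space of the diagonal action
`g • ((v₁, v₂), x) = ((v₁ g⁻¹, v₂ g⁻¹), g • x)` on `U(ℍ²) × M`. -/
abbrev TotalSpace (M : Type) [MulAction SU2 M] : Type :=
  MulAction.orbitRel.Quotient SU2 (UnitH2 × M)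

/-- The point `[v₁ : v₂]` of `S⁴`. -/
def basePt (v : UnitH2) : S4 := Quotient.mk _ v

theorem continuous_basePt : Continuous basePt := continuous_quot_mk

theorem basePt_eq {v w : UnitH2} (g : SU2) (h : g • w = v) : basePt v = basePt w :=
  Quotient.sound ⟨g, h⟩

section Bundle

variable {M : Type} [MulAction SU2 M]

/-- The point `[v, x]` of the total space. -/
def totalPt (v : UnitH2) (x : M) : TotalSpace M := Quotient.mk _ (v, x)

/-- The bundle projection `[v, x] ↦ [v]`. -/
def proj : TotalSpace M → S4 :=
  Quotient.lift (fun p : UnitH2 × M => basePt p.1) (by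
    rintro p q ⟨g, hg⟩
    exact basePt_eq g (congrArg Prod.fst hg))

/-- The map `(v₁, v₂) ↦ (h⁻¹ v₁, v₂)` of `U(ℍ²)`. -/
def rot (h : SU2) (v : UnitH2) : UnitH2 :=
  ⟨(((h⁻¹ : SU2) : ℍ) * v.1.1, v.1.2), by
    simp only [norm_mul, norm_su2, one_mul]; exact v.2⟩

theorem rot_smul (h g : SU2) (v : UnitH2) : rot h (g • v) = g • rot h v := by
  apply Subtype.ext
  change (((h⁻¹ : SU2) : ℍ) * (v.1.1 * ((g⁻¹ : SU2) : ℍ)), v.1.2 * ((g⁻¹ : SU2) : ℍ)) =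
    ((((h⁻¹ : SU2) : ℍ) * v.1.1) * ((g⁻¹ : SU2) : ℍ), v.1.2 * ((g⁻¹ : SU2) : ℍ))
  rw [mul_assoc]

/-- The second `SU(2)`-action on the base: `(h, [v₁ : v₂]) ↦ [h⁻¹ v₁ : v₂]`. -/
def rotBase (h : SU2) : S4 → S4 :=
  Quotient.lift (fun v => basePt (rot h v)) (by
    rintro v w ⟨g, hg⟩
    have hg' : g • w = v := hg
    exact basePt_eq g (by rw [← rot_smul, hg']))

/-- The second `SU(2)`-action on the total space: `(h, [(v₁, v₂), x]) ↦ [(h⁻¹ v₁, v₂), x]`. -/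
def rotTotal (h : SU2) : TotalSpace M → TotalSpace M :=
  Quotient.lift (fun p : UnitH2 × M => totalPt (rot h p.1) p.2) (by
    rintro p q ⟨g, hg⟩
    have h1 : g • q.1 = p.1 := congrArg Prod.fst hg
    have h2 : g • q.2 = p.2 := congrArg Prod.snd hg
    exact Quotient.sound ⟨g, Prod.ext (by
      change g • rot h q.1 = rot h p.1
      rw [← rot_smul, h1]) h2⟩)

variable [TopologicalSpace M]

/-- A continuous map `s : S⁴ → P⁰` is a section of the bundle. -/
def IsSection (s : C(S4, TotalSpace M)) : Prop := ∀ b, proj (s b) = b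

/-- `s : S⁴ → P⁰` is equivariant for the second `SU(2)`-action. -/
def IsEquivariant (s : C(S4, TotalSpace M)) : Prop :=
  ∀ (h : SU2) (b : S4), s (rotBase h b) = rotTotal h (s b)

/-- The inclusion `x ↦ [v, x]` of `M` as the fibre over `[v]`. -/
def fiberIncl (v : UnitH2) : C(M, TotalSpace M) where
  toFun x := totalPt v x
  continuous_toFun := continuous_quot_mk.comp (Continuous.prodMk_right v)

end Bundle

/-! ### Singular homology and the Hurewicz map in degree four -/

open CategoryTheory AlgebraicTopology

/-- The singular homology group `H₄(X; ℤ)`. -/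
abbrev H4 (X : Type) [TopologicalSpace X] : ModuleCat.{0} ℤ :=
  ((singularHomologyFunctor (ModuleCat.{0} ℤ) 4).obj (ModuleCat.of ℤ ℤ)).obj (TopCat.of X)

/-- The induced map `f_* : H₄(X; ℤ) → H₄(Y; ℤ)`. -/
def H4map {X Y : Type} [TopologicalSpace X] [TopologicalSpace Y] (f : C(X, Y)) :
    H4 X →ₗ[ℤ] H4 Y :=
  (((singularHomologyFunctor (ModuleCat.{0} ℤ) 4).obj (ModuleCat.of ℤ ℤ)).map
    (TopCat.ofHom f)).hom

theorem H4map_congr {X Y : Type} [TopologicalSpace X] [TopologicalSpace Y] {f g : C(X, Y)}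
    (h : f.Homotopic g) : H4map f = H4map g := by
  obtain ⟨F⟩ := h
  have F' : TopCat.Homotopy (TopCat.ofHom f) (TopCat.ofHom g) := F
  exact congrArg ModuleCat.Hom.hom
    (F'.congr_homologyMap_singularChainComplexFunctor (ModuleCat.of ℤ ℤ) 4)

/-- The singular simplex of `X` given by a continuous map `Δ⁴ → X`. -/
def simplex {X : Type} [TopologicalSpace X] (f : C(stdSimplex ℝ (Fin 5), X)) :
    (TopCat.toSSet.obj (TopCat.of X)) _⦋4⦌ :=
  ((TopCat.of X).toSSetObjEquiv (.op ⦋4⦌)).symm f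

theorem simplex_face_eq {X : Type} [TopologicalSpace X] {f g : C(stdSimplex ℝ (Fin 5), X)}
    (h : ∀ x : stdSimplex ℝ (Fin 5), (∃ i, x i = 0) → f x = g x) (i : Fin 5) :
    (TopCat.toSSet.obj (TopCat.of X)).δ i (simplex f) =
      (TopCat.toSSet.obj (TopCat.of X)).δ i (simplex g) := by
  apply ((TopCat.of X).toSSetObjEquiv (.op ⦋3⦌)).injective
  ext y
  refine h (stdSimplex.map (SimplexCategory.δ i) y) ⟨i, ?_⟩
  rw [stdSimplex.map_coe, FunOnFinite.linearMap_apply_apply]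
  refine Finset.sum_eq_zero fun j hj => ?_
  exact absurd (Finset.mem_filter.1 hj).2 (Fin.succAbove_ne i j)

/-- If two singular 4-simplices `f`, `g` agree on `∂Δ⁴`, then `f - g` is a cycle. -/
theorem simplex_sub_cycle {X : Type} [TopologicalSpace X] {f g : C(stdSimplex ℝ (Fin 5), X)}
    (h : ∀ x : stdSimplex ℝ (Fin 5), (∃ i, x i = 0) → f x = g x) :
    (SSet.ιChainComplex (R := ModuleCat.of ℤ ℤ) _ (simplex f) -
      SSet.ιChainComplex (R := ModuleCat.of ℤ ℤ) _ (simplex g)) ≫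
      ((TopCat.toSSet.obj (TopCat.of X)).chainComplex (ModuleCat.of ℤ ℤ)).d 4 3 = 0 := by
  rw [Preadditive.sub_comp, SSet.ιChainComplex_d, SSet.ιChainComplex_d, sub_eq_zero]
  exact Finset.sum_congr rfl fun i _ => by rw [simplex_face_eq h i]

/-- The class in `H₄(X; ℤ)` of the cycle `f - g`, for singular 4-simplices `f`, `g` that agree
on `∂Δ⁴`. -/
def differenceClass {X : Type} [TopologicalSpace X] (f g : C(stdSimplex ℝ (Fin 5), X))
    (h : ∀ x : stdSimplex ℝ (Fin 5), (∃ i, x i = 0) → f x = g x) : H4 X :=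
  (((TopCat.toSSet.obj (TopCat.of X)).chainComplex (ModuleCat.of ℤ ℤ)).liftCycles
      (SSet.ιChainComplex (R := ModuleCat.of ℤ ℤ) _ (simplex f) -
        SSet.ιChainComplex (R := ModuleCat.of ℤ ℤ) _ (simplex g)) 3 (by simp)
      (simplex_sub_cycle h) ≫
    ((TopCat.toSSet.obj (TopCat.of X)).chainComplex (ModuleCat.of ℤ ℤ)).homologyπ 4).hom (1 : ℤ)

/-- The relation on the cube `I⁴` that collapses the boundary `∂I⁴` to a point. -/
def cubeSetoid : Setoid (I^ (Fin 4)) where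
  r a b := a = b ∨ (a ∈ Cube.boundary (Fin 4) ∧ b ∈ Cube.boundary (Fin 4))
  iseqv := ⟨fun _ => Or.inl rfl, by
    rintro a b (h | h)
    exacts [Or.inl h.symm, Or.inr h.symm], by
    rintro a b c (rfl | h) (rfl | h')
    exacts [Or.inl rfl, Or.inr h', Or.inr h, Or.inr ⟨h.1, h'.2⟩]⟩

/-- The 4-sphere `I⁴/∂I⁴`. -/
def CubeSphere : Type := Quotient cubeSetoid

instance : TopologicalSpace CubeSphere := inferInstanceAs (TopologicalSpace (Quotient cubeSetoid))

/-- The quotient map `I⁴ → I⁴/∂I⁴`. -/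
def collapse : C(I^ (Fin 4), CubeSphere) where
  toFun t := Quotient.mk cubeSetoid t
  continuous_toFun := continuous_quot_mk

theorem collapse_isQuotientMap : Topology.IsQuotientMap collapse := isQuotientMap_quot_mk

theorem zero_mem_boundary : (0 : I^ (Fin 4)) ∈ Cube.boundary (Fin 4) := ⟨0, Or.inl rfl⟩

/-- The vector `(x₁, x₂, x₃, x₄)` of all barycentric coordinates of `x ∈ Δ⁴` but `x₀`. -/
def tailCoords (x : stdSimplex ℝ (Fin 5)) : Fin 4 → ℝ := fun j => x j.succ

/-- The homeomorphism of pairs `(Δ⁴, ∂Δ⁴) → (I⁴, ∂I⁴)` that rescales each ray from the vertex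
`x₀ = 1` to the vertex `0`: it sends `x` to
`(x₁ + ⋯ + x₄) / max (x₁, …, x₄) • (x₁, x₂, x₃, x₄)`, where `‖·‖` below is the maximum norm. -/
def simplexToCubeFun (x : stdSimplex ℝ (Fin 5)) : Fin 4 → ℝ := fun i =>
  (∑ j, tailCoords x j) * (tailCoords x i / ‖tailCoords x‖)

theorem continuous_tailCoords : Continuous tailCoords :=
  continuous_pi fun j => (continuous_apply j.succ).comp continuous_subtype_val

theorem tailCoords_nonneg (x : stdSimplex ℝ (Fin 5)) (j : Fin 4) : 0 ≤ tailCoords x j :=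
  x.2.1 j.succ

theorem sum_tailCoords (x : stdSimplex ℝ (Fin 5)) : x 0 + ∑ j, tailCoords x j = 1 := by
  have h := x.2.2
  rw [Fin.sum_univ_succ] at h
  exact h

theorem tailCoords_le (x : stdSimplex ℝ (Fin 5)) (j : Fin 4) :
    tailCoords x j ≤ ‖tailCoords x‖ :=
  (le_abs_self _).trans (norm_le_pi_norm (tailCoords x) j)

theorem tail_ratio_mem (x : stdSimplex ℝ (Fin 5)) (i : Fin 4) :
    tailCoords x i / ‖tailCoords x‖ ∈ I :=
  ⟨div_nonneg (tailCoords_nonneg x i) (norm_nonneg _),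
    div_le_one_of_le₀ (tailCoords_le x i) (norm_nonneg _)⟩

theorem sum_tailCoords_mem (x : stdSimplex ℝ (Fin 5)) : ∑ j, tailCoords x j ∈ I :=
  ⟨Finset.sum_nonneg fun j _ => tailCoords_nonneg x j, by
    have h0 : 0 ≤ x 0 := x.2.1 0
    linarith [sum_tailCoords x]⟩

theorem simplexToCubeFun_continuous : Continuous simplexToCubeFun := by
  have hs : Continuous fun x : stdSimplex ℝ (Fin 5) => ∑ j, tailCoords x j :=
    continuous_finsetSum _ fun j _ => (continuous_apply j).comp continuous_tailCoords
  refine continuous_pi fun i => continuous_iff_continuousAt.2 fun x => ?_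
  by_cases hx : tailCoords x = 0
  · have h0 : ∑ j, tailCoords x j = 0 := by simp [hx]
    have h1 : simplexToCubeFun x i = 0 := by simp [simplexToCubeFun, h0]
    rw [ContinuousAt, h1]
    have hlim := hs.continuousAt (x := x)
    rw [ContinuousAt, h0] at hlim
    refine squeeze_zero (fun y => ?_) (fun y => ?_) hlim
    · exact mul_nonneg (sum_tailCoords_mem y).1 (tail_ratio_mem y i).1
    · exact mul_le_of_le_one_right (sum_tailCoords_mem y).1 (tail_ratio_mem y i).2
  · exact hs.continuousAt.mul
      (((continuous_apply i).comp continuous_tailCoords).continuousAt.div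
        continuous_tailCoords.norm.continuousAt (norm_ne_zero_iff.2 hx))

theorem simplexToCubeFun_mem (x : stdSimplex ℝ (Fin 5)) (i : Fin 4) :
    simplexToCubeFun x i ∈ I :=
  unitInterval.mul_mem (sum_tailCoords_mem x) (tail_ratio_mem x i)

/-- The homeomorphism `Δ⁴ → I⁴` described at `simplexToCubeFun`. -/
def simplexToCube : C(stdSimplex ℝ (Fin 5), I^ (Fin 4)) where
  toFun x i := ⟨simplexToCubeFun x i, simplexToCubeFun_mem x i⟩
  continuous_toFun := continuous_pi fun i =>
    ((continuous_apply i).comp simplexToCubeFun_continuous).subtype_mk _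

theorem simplexToCube_boundary (x : stdSimplex ℝ (Fin 5)) (hx : ∃ i, x i = 0) :
    simplexToCube x ∈ Cube.boundary (Fin 4) := by
  obtain ⟨k, hk⟩ := hx
  induction k using Fin.cases with
  | zero =>
    have hs : ∑ j, tailCoords x j = 1 := by linarith [sum_tailCoords x]
    have hne : tailCoords x ≠ 0 := fun h => by simp [h] at hs
    obtain ⟨i, hi⟩ := Finite.exists_max (tailCoords x)
    refine ⟨i, Or.inr (Subtype.ext ?_)⟩
    have hn : ‖tailCoords x‖ = tailCoords x i := by
      refine le_antisymm ((pi_norm_le_iff_of_nonneg (tailCoords_nonneg x i)).2 fun j => ?_)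
        (tailCoords_le x i)
      rw [Real.norm_of_nonneg (tailCoords_nonneg x j)]
      exact hi j
    change (∑ j, tailCoords x j) * (tailCoords x i / ‖tailCoords x‖) = 1
    rw [hs, ← hn, div_self (norm_ne_zero_iff.2 hne), one_mul]
  | succ j =>
    refine ⟨j, Or.inl (Subtype.ext ?_)⟩
    change (∑ j, tailCoords x j) * (x j.succ / ‖tailCoords x‖) = 0
    rw [hk, zero_div, mul_zero]

/-- The fundamental class of `I⁴/∂I⁴`, oriented by the standard orientation of the cube: the
class of the cycle `Δ⁴ ≅ I⁴ → I⁴/∂I⁴` minus the constant simplex at the collapsed boundary. -/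
def cubeClass : H4 CubeSphere :=
  differenceClass (collapse.comp simplexToCube) (ContinuousMap.const _ (collapse 0))
    fun x hx => Quotient.sound (Or.inr ⟨simplexToCube_boundary x hx, zero_mem_boundary⟩)

section Hurewicz

variable {X Y : Type} [TopologicalSpace X] [TopologicalSpace Y]

/-- The map `I⁴/∂I⁴ → X` induced by a map `(I⁴, ∂I⁴) → (X, x)`. -/
def ofGenLoop {x : X} (f : GenLoop (Fin 4) X x) : C(CubeSphere, X) where
  toFun := Quotient.lift (fun t => f t) (by
    rintro a b (rfl | ⟨ha, hb⟩)
    · rfl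
    · rw [GenLoop.boundary f a ha, GenLoop.boundary f b hb])
  continuous_toFun := Continuous.quotient_lift f.1.continuous _

theorem ofGenLoop_homotopic {x : X} {f g : GenLoop (Fin 4) X x} (h : GenLoop.Homotopic f g) :
    (ofGenLoop f).Homotopic (ofGenLoop g) := by
  obtain ⟨F⟩ := h
  have hF : ∀ (s : I) (t : I^ (Fin 4)), t ∈ Cube.boundary (Fin 4) → F (s, t) = x := fun s t ht =>
    (F.eq_fst s ht).trans (GenLoop.boundary f t ht)
  let G : I × CubeSphere → X := fun p => Quotient.lift (fun t => F (p.1, t)) (by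
    rintro a b (rfl | ⟨ha, hb⟩)
    · rfl
    · rw [hF p.1 a ha, hF p.1 b hb]) p.2
  have hG : Continuous G := collapse_isQuotientMap.continuous_lift_prod_right F.continuous
  exact ⟨{ toFun := G
           continuous_toFun := hG
           map_zero_left := fun q => Quotient.inductionOn q fun t => F.apply_zero t
           map_one_left := fun q => Quotient.inductionOn q fun t => F.apply_one t }⟩

/-- The Hurewicz image `f_*[I⁴/∂I⁴]` of a map `f : (I⁴, ∂I⁴) → (X, x)`. -/
def hurewiczLoop {x : X} (f : GenLoop (Fin 4) X x) : H4 X := H4map (ofGenLoop f) cubeClass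

/-- The Hurewicz map `π₄(X, x) → H₄(X; ℤ)`. -/
def hurewicz {x : X} : π_ 4 X x → H4 X :=
  Quotient.lift hurewiczLoop fun _ _ h => by
    unfold hurewiczLoop
    rw [H4map_congr (ofGenLoop_homotopic h)]

/-- The induced map `f_* : π₄(X, x) → π₄(Y, f x)`. -/
def pi4map (f : C(X, Y)) (x : X) : π_ 4 X x → π_ 4 Y (f x) :=
  Quotient.map
    (fun a : GenLoop (Fin 4) X x =>
      (⟨f.comp a.1, fun t ht => congrArg f (a.2 t ht)⟩ : GenLoop (Fin 4) Y (f x)))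
    fun _ _ h => ContinuousMap.HomotopicRel.comp_continuousMap h f

end Hurewicz

/-! ### The fundamental class of the base -/

/-- The vector `2t - 1 ∈ [-1, 1]⁴ ⊆ ℍ`, in the coordinates `1, i, j, k` of `ℍ`. -/
def cubeVec (t : I^ (Fin 4)) : ℍ :=
  ⟨2 * (t 0 : ℝ) - 1, 2 * (t 1 : ℝ) - 1, 2 * (t 2 : ℝ) - 1, 2 * (t 3 : ℝ) - 1⟩

/-- The function `∏ tᵢ (1 - tᵢ)`, which vanishes exactly on the boundary of the cube. -/
def cubeBump (t : I^ (Fin 4)) : ℝ := ∏ i, (t i : ℝ) * (1 - (t i : ℝ))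

/-- The length of `(2t - 1, ∏ tᵢ (1 - tᵢ)) ∈ ℍ²`. -/
def cubeNorm (t : I^ (Fin 4)) : ℝ := Real.sqrt (‖cubeVec t‖ ^ 2 + cubeBump t ^ 2)

theorem continuous_cubeVec : Continuous cubeVec := by
  have h : cubeVec = fun t : I^ (Fin 4) => Quaternion.linearIsometryEquivTuple.symm
      (WithLp.toLp 2 ![2 * (t 0 : ℝ) - 1, 2 * (t 1 : ℝ) - 1, 2 * (t 2 : ℝ) - 1,
        2 * (t 3 : ℝ) - 1]) := rfl
  rw [h]
  refine Quaternion.linearIsometryEquivTuple.symm.continuous.comp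
    ((PiLp.continuous_toLp 2 _).comp (continuous_pi fun i => ?_))
  fin_cases i <;> simp <;> fun_prop

theorem continuous_cubeBump : Continuous cubeBump := by
  unfold cubeBump
  fun_prop

theorem cubeBump_eq_zero_iff (t : I^ (Fin 4)) :
    cubeBump t = 0 ↔ t ∈ Cube.boundary (Fin 4) := by
  unfold cubeBump
  rw [Finset.prod_eq_zero_iff]
  constructor
  · rintro ⟨i, -, hi⟩
    rcases mul_eq_zero.1 hi with h | h
    · exact ⟨i, Or.inl (Subtype.ext h)⟩
    · exact ⟨i, Or.inr (Subtype.ext (sub_eq_zero.1 h).symm)⟩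
  · rintro ⟨i, h | h⟩ <;> exact ⟨i, Finset.mem_univ _, by simp [h]⟩

theorem cubeSq_pos (t : I^ (Fin 4)) : 0 < ‖cubeVec t‖ ^ 2 + cubeBump t ^ 2 := by
  by_cases hb : cubeBump t = 0
  · have hn : ‖cubeVec t‖ ^ 2 = (2 * (t 0 : ℝ) - 1) ^ 2 + (2 * (t 1 : ℝ) - 1) ^ 2 +
        (2 * (t 2 : ℝ) - 1) ^ 2 + (2 * (t 3 : ℝ) - 1) ^ 2 := by
      rw [sq, ← Quaternion.normSq_eq_norm_mul_self, Quaternion.normSq_def']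
      rfl
    obtain ⟨i, hi⟩ := (cubeBump_eq_zero_iff t).1 hb
    have h1 : (2 * (t i : ℝ) - 1) ^ 2 = 1 := by
      rcases hi with h | h <;> rw [h] <;> norm_num
    rw [hn]
    fin_cases i <;> simp only [Fin.zero_eta, Fin.mk_one, Fin.reduceFinMk] at h1 <;>
      rw [h1] <;> positivity
  · positivity

theorem cubeNorm_pos (t : I^ (Fin 4)) : 0 < cubeNorm t := Real.sqrt_pos.2 (cubeSq_pos t)

theorem continuous_cubeNorm : Continuous cubeNorm :=
  ((continuous_cubeVec.norm.pow 2).add (continuous_cubeBump.pow 2)).sqrt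

/-- The unit vector of `ℍ²` in the direction of `(2t - 1, ∏ tᵢ (1 - tᵢ))`. -/
def cubeUnit (t : I^ (Fin 4)) : UnitH2 :=
  ⟨((cubeNorm t)⁻¹ • cubeVec t, (cubeNorm t)⁻¹ • (cubeBump t : ℍ)), by
    have h : cubeNorm t ^ 2 = ‖cubeVec t‖ ^ 2 + cubeBump t ^ 2 := Real.sq_sqrt (cubeSq_pos t).le
    have h0 := (cubeNorm_pos t).ne'
    simp only [norm_smul, mul_pow, norm_inv, Quaternion.norm_coe, Real.norm_eq_abs, sq_abs,
      inv_pow]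
    rw [← mul_add, ← h, inv_mul_cancel₀ (pow_ne_zero 2 h0)]⟩

theorem continuous_cubeUnit : Continuous cubeUnit := by
  have h : Continuous fun t => (cubeNorm t)⁻¹ :=
    continuous_cubeNorm.inv₀ fun t => (cubeNorm_pos t).ne'
  exact ((h.smul continuous_cubeVec).prodMk
    (h.smul (Quaternion.continuous_coe.comp continuous_cubeBump))).subtype_mk _

/-- The pole `[1 : 0]` of `S⁴`. -/
def pole : S4 := basePt ⟨(1, 0), by simp⟩

theorem basePt_eq_pole (v : UnitH2) (hv : v.1.2 = 0) : basePt v = pole := by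
  have h1 : ‖v.1.1‖ = 1 := by
    have h := v.2
    rw [hv, norm_zero] at h
    nlinarith [norm_nonneg v.1.1]
  let g : SU2 := ⟨v.1.1, mem_sphere_zero_iff_norm.2 h1⟩
  refine basePt_eq g⁻¹ (Subtype.ext ?_)
  change ((1 : ℍ) * ((g⁻¹⁻¹ : SU2) : ℍ), (0 : ℍ) * ((g⁻¹⁻¹ : SU2) : ℍ)) = v.1
  rw [inv_inv, one_mul, zero_mul]
  exact Prod.ext rfl hv.symm

/-- The map `t ↦ [2t - 1 : ∏ tᵢ (1 - tᵢ)]` from the cube to `S⁴`. It maps the interior of the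
cube homeomorphically, and with the orientation kept, onto the affine chart `{[q : 1] | q ∈ ℍ}`,
and the boundary to the point `[1 : 0]`; so it induces a homeomorphism `I⁴/∂I⁴ ≅ S⁴`. -/
def cubeToS4 : GenLoop (Fin 4) S4 pole :=
  ⟨⟨fun t => basePt (cubeUnit t), continuous_basePt.comp continuous_cubeUnit⟩, fun t ht =>
    basePt_eq_pole _ (by
      change (cubeNorm t)⁻¹ • (cubeBump t : ℍ) = 0
      rw [(cubeBump_eq_zero_iff t).2 ht, Quaternion.coe_zero, smul_zero])⟩

/-- The fundamental class `[S⁴] ∈ H₄(S⁴; ℤ)`, for the orientation of the chart `[q : 1]`. -/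
def fundamentalClass : H4 S4 := hurewiczLoop cubeToS4

end SU2Bundle

end

/-! The base point `[1 : 0]` is fixed by the second action, and over it left and right
multiplication agree: `[(h⁻¹, 0), x] = [(1, 0), h⁻¹ x]`. So the value of an equivariant section
there is a fixed point of the action on `M`. Conversely, a fixed point `x` gives the section `[v] ↦
[v, x]`.

For the homology statement, sections are pulled back to the cube along `cubeToS4`, which lifts to
`U(ℍ²)`. A section becomes a map `f : I⁴ → M`, and since `∂I⁴` goes to the pole its boundary values
are forced: `f t = c(t)⁻¹ y`, with `c` the clutching map and `[(1, 0), y]` the value at the pole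
(`exists_section_coordinate`). The class of the section is that of the simplex of `f` minus a
constant simplex.

As `M` is path connected, homotopy extension moves the point `y` of one section to that of the
other. Then both maps agree on `∂I⁴`, and the constant simplices cancel in the difference. Finally
the lift is deformed to the constant `v` and the map being subtracted to the constant `m`, dragging
the other map along by homotopy extension (`differenceClass_mem_range_hurewicz`). What remains is
the Hurewicz image of a 4-loop in the fibre. These moves preserve the homology class by
`differenceClass_homotopy`. -/

noncomputable section

namespace SU2Bundle

open CategoryTheory AlgebraicTopology

/-! ### Difference classes of singular simplices that agree on the boundary -/

section Homology

variable {X Y : Type} [TopologicalSpace X] [TopologicalSpace Y]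

theorem toSSet_map_simplex (φ : C(X, Y)) (f : C(stdSimplex ℝ (Fin 5), X)) :
    (TopCat.toSSet.map (TopCat.ofHom φ)).app (.op ⦋4⦌) (simplex f) = simplex (φ.comp f) :=
  rfl

theorem H4map_differenceClass (φ : C(X, Y)) {f g : C(stdSimplex ℝ (Fin 5), X)}
    (h : ∀ x : stdSimplex ℝ (Fin 5), (∃ i, x i = 0) → f x = g x) :
    H4map φ (differenceClass f g h) =
      differenceClass (φ.comp f) (φ.comp g) fun x hx => congrArg φ (h x hx) := by
  have key : (((TopCat.toSSet.obj (TopCat.of X)).chainComplex (ModuleCat.of ℤ ℤ)).liftCycles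
      (SSet.ιChainComplex (R := ModuleCat.of ℤ ℤ) _ (simplex f) -
        SSet.ιChainComplex (R := ModuleCat.of ℤ ℤ) _ (simplex g)) 3 (by simp)
      (simplex_sub_cycle h) ≫
    ((TopCat.toSSet.obj (TopCat.of X)).chainComplex (ModuleCat.of ℤ ℤ)).homologyπ 4) ≫
      HomologicalComplex.homologyMap (SSet.chainComplexMap (TopCat.toSSet.map (TopCat.ofHom φ))
        (ModuleCat.of ℤ ℤ)) 4 =
      ((TopCat.toSSet.obj (TopCat.of Y)).chainComplex (ModuleCat.of ℤ ℤ)).liftCycles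
      (SSet.ιChainComplex (R := ModuleCat.of ℤ ℤ) _ (simplex (φ.comp f)) -
        SSet.ιChainComplex (R := ModuleCat.of ℤ ℤ) _ (simplex (φ.comp g))) 3 (by simp)
      (simplex_sub_cycle fun x hx => congrArg φ (h x hx)) ≫
    ((TopCat.toSSet.obj (TopCat.of Y)).chainComplex (ModuleCat.of ℤ ℤ)).homologyπ 4 := by
    rw [Category.assoc, HomologicalComplex.homologyπ_naturality, ← Category.assoc]
    congr 1
    rw [HomologicalComplex.liftCycles_comp_cyclesMap]
    congr 1
    rw [Preadditive.sub_comp, SSet.ι_chainComplexMap_f, SSet.ι_chainComplexMap_f,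
      toSSet_map_simplex, toSSet_map_simplex]
  exact congrArg (fun ψ => ψ.hom (1 : ℤ)) key

/-- The common simplex `g` already cancels at the level of chains. -/
theorem differenceClass_sub {f f' g : C(stdSimplex ℝ (Fin 5), X)}
    (h : ∀ x : stdSimplex ℝ (Fin 5), (∃ i, x i = 0) → f x = g x)
    (h' : ∀ x : stdSimplex ℝ (Fin 5), (∃ i, x i = 0) → f' x = g x) :
    differenceClass f g h - differenceClass f' g h' =
      differenceClass f f' fun x hx => (h x hx).trans (h' x hx).symm := by
  have key := congrArg (fun ψ => (ψ ≫ ((TopCat.toSSet.obj (TopCat.of X)).chainComplex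
      (ModuleCat.of ℤ ℤ)).homologyπ 4).hom (1 : ℤ))
    (show ((TopCat.toSSet.obj (TopCat.of X)).chainComplex (ModuleCat.of ℤ ℤ)).liftCycles
      (SSet.ιChainComplex (R := ModuleCat.of ℤ ℤ) _ (simplex f) -
        SSet.ιChainComplex (R := ModuleCat.of ℤ ℤ) _ (simplex g)) 3 (by simp)
      (simplex_sub_cycle h) -
    ((TopCat.toSSet.obj (TopCat.of X)).chainComplex (ModuleCat.of ℤ ℤ)).liftCycles
      (SSet.ιChainComplex (R := ModuleCat.of ℤ ℤ) _ (simplex f') -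
        SSet.ιChainComplex (R := ModuleCat.of ℤ ℤ) _ (simplex g)) 3 (by simp)
      (simplex_sub_cycle h') =
    ((TopCat.toSSet.obj (TopCat.of X)).chainComplex (ModuleCat.of ℤ ℤ)).liftCycles
      (SSet.ιChainComplex (R := ModuleCat.of ℤ ℤ) _ (simplex f) -
        SSet.ιChainComplex (R := ModuleCat.of ℤ ℤ) _ (simplex f')) 3 (by simp)
      (simplex_sub_cycle fun x hx => (h x hx).trans (h' x hx).symm) by
    -- The inclusion of cycles into chains is mono, so the lifts can be compared as chains.
    rw [← cancel_mono (((TopCat.toSSet.obj (TopCat.of X)).chainComplex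
      (ModuleCat.of ℤ ℤ)).iCycles 4), Preadditive.sub_comp, HomologicalComplex.liftCycles_i,
      HomologicalComplex.liftCycles_i, HomologicalComplex.liftCycles_i, sub_sub_sub_cancel_right])
  rw [Preadditive.sub_comp] at key
  exact key

theorem differenceClass_congr {f g f' g' : C(stdSimplex ℝ (Fin 5), X)} (hf : f = f')
    (hg : g = g') (h : ∀ x : stdSimplex ℝ (Fin 5), (∃ i, x i = 0) → f x = g x)
    (h' : ∀ x : stdSimplex ℝ (Fin 5), (∃ i, x i = 0) → f' x = g' x) :
    differenceClass f g h = differenceClass f' g' h' := by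
  subst hf hg
  rfl

/-- A continuous function on `Δ⁴` that vanishes exactly on the boundary. -/
def simplexBump (x : stdSimplex ℝ (Fin 5)) : ℝ := ∏ i, x i

theorem continuous_simplexBump : Continuous simplexBump :=
  continuous_finsetProd _ fun i _ => (continuous_apply i).comp continuous_subtype_val

theorem simplexBump_nonneg (x : stdSimplex ℝ (Fin 5)) : 0 ≤ simplexBump x :=
  Finset.prod_nonneg fun i _ => x.2.1 i

theorem exists_eq_zero_of_simplexBump {x : stdSimplex ℝ (Fin 5)} (h : simplexBump x = 0) :
    ∃ i, x i = 0 := by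
  obtain ⟨i, -, hi⟩ := Finset.prod_eq_zero_iff.1 h
  exact ⟨i, hi⟩

theorem simplexBump_eq_zero {x : stdSimplex ℝ (Fin 5)} (h : ∃ i, x i = 0) :
    simplexBump x = 0 := by
  obtain ⟨i, hi⟩ := h
  exact Finset.prod_eq_zero (Finset.mem_univ i) hi

/-- Two copies of `Δ⁴` glued along the boundary, as the graphs of `± simplexBump`. -/
def SimplexDouble : Type :=
  {p : stdSimplex ℝ (Fin 5) × ℝ // p.2 = simplexBump p.1 ∨ p.2 = -simplexBump p.1}

instance : TopologicalSpace SimplexDouble :=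
  inferInstanceAs (TopologicalSpace
    {p : stdSimplex ℝ (Fin 5) × ℝ // p.2 = simplexBump p.1 ∨ p.2 = -simplexBump p.1})

/-- The upper copy of `Δ⁴` in the double. -/
def doubleUpper : C(stdSimplex ℝ (Fin 5), SimplexDouble) where
  toFun x := ⟨(x, simplexBump x), Or.inl rfl⟩
  continuous_toFun := (continuous_id.prodMk continuous_simplexBump).subtype_mk _

/-- The lower copy of `Δ⁴` in the double. -/
def doubleLower : C(stdSimplex ℝ (Fin 5), SimplexDouble) where
  toFun x := ⟨(x, -simplexBump x), Or.inr rfl⟩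
  continuous_toFun := (continuous_id.prodMk continuous_simplexBump.neg).subtype_mk _

theorem doubleUpper_eq_doubleLower (x : stdSimplex ℝ (Fin 5)) (hx : ∃ i, x i = 0) :
    doubleUpper x = doubleLower x :=
  Subtype.ext (Prod.ext rfl (by
    change simplexBump x = -simplexBump x
    rw [simplexBump_eq_zero hx, neg_zero]))

/-- The map out of the double given by `F` on the upper and `G` on the lower copy. -/
def doubleGlueFun (F G : I × stdSimplex ℝ (Fin 5) → X) (p : I × SimplexDouble) : X :=
  if 0 ≤ p.2.1.2 then F (p.1, p.2.1.1) else G (p.1, p.2.1.1)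

theorem continuous_doubleGlueFun (F G : C(I × stdSimplex ℝ (Fin 5), X))
    (h : ∀ (s : I) (x : stdSimplex ℝ (Fin 5)), (∃ i, x i = 0) → F (s, x) = G (s, x)) :
    Continuous (doubleGlueFun F G) := by
  have hp : Continuous fun p : I × SimplexDouble => p.2.1 :=
    continuous_subtype_val.comp continuous_snd
  have hq : Continuous fun p : I × SimplexDouble => (p.1, p.2.1.1) :=
    continuous_fst.prodMk (continuous_fst.comp hp)
  refine Continuous.if_le (F.continuous.comp hq) (G.continuous.comp hq) continuous_const
    (continuous_snd.comp hp) fun p hz => h _ _ (exists_eq_zero_of_simplexBump ?_)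
  rcases p.2.2 with h2 | h2 <;> linarith

/-- A pair of simplices that agree on `∂Δ⁴` is a single map out of the double of `Δ⁴`, and its
difference class is the image of one universal class of the double. A homotopy of pairs is thus a
homotopy of maps on the double, and homotopy invariance of `H4` applies. -/
theorem differenceClass_homotopy (F G : C(I × stdSimplex ℝ (Fin 5), X))
    (h : ∀ (s : I) (x : stdSimplex ℝ (Fin 5)), (∃ i, x i = 0) → F (s, x) = G (s, x))
    {f₀ g₀ f₁ g₁ : C(stdSimplex ℝ (Fin 5), X)}
    (hf₀ : ∀ x, F (0, x) = f₀ x) (hg₀ : ∀ x, G (0, x) = g₀ x)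
    (hf₁ : ∀ x, F (1, x) = f₁ x) (hg₁ : ∀ x, G (1, x) = g₁ x)
    (h₀ : ∀ x : stdSimplex ℝ (Fin 5), (∃ i, x i = 0) → f₀ x = g₀ x)
    (h₁ : ∀ x : stdSimplex ℝ (Fin 5), (∃ i, x i = 0) → f₁ x = g₁ x) :
    differenceClass f₀ g₀ h₀ = differenceClass f₁ g₁ h₁ := by
  let K : C(I × SimplexDouble, X) := ⟨doubleGlueFun F G, continuous_doubleGlueFun F G h⟩
  let k (s : I) : C(SimplexDouble, X) :=
    ⟨fun p => K (s, p), K.continuous.comp (Continuous.prodMk_right s)⟩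
  have hk : (k 0).Homotopic (k 1) :=
    ⟨{ toFun := K
       continuous_toFun := K.continuous
       map_zero_left := fun _ => rfl
       map_one_left := fun _ => rfl }⟩
  have hu : ∀ s x, k s (doubleUpper x) = F (s, x) := fun s x =>
    if_pos (simplexBump_nonneg x)
  have hl : ∀ s x, k s (doubleLower x) = G (s, x) := fun s x => by
    change (if 0 ≤ -simplexBump x then F (s, x) else G (s, x)) = _
    -- The lower sheet passes the sign test only where it meets the upper one, and there `F` and `G`
    -- agree.
    split_ifs with hx
    · exact h s x (exists_eq_zero_of_simplexBump (by linarith [simplexBump_nonneg x]))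
    · rfl
  have hc := congrArg (fun φ => φ (differenceClass doubleUpper doubleLower
    doubleUpper_eq_doubleLower)) (H4map_congr hk)
  simp only [H4map_differenceClass] at hc
  have e1 : (k 0).comp doubleUpper = f₀ := ContinuousMap.ext fun x => (hu 0 x).trans (hf₀ x)
  have e2 : (k 0).comp doubleLower = g₀ := ContinuousMap.ext fun x => (hl 0 x).trans (hg₀ x)
  have e3 : (k 1).comp doubleUpper = f₁ := ContinuousMap.ext fun x => (hu 1 x).trans (hf₁ x)
  have e4 : (k 1).comp doubleLower = g₁ := ContinuousMap.ext fun x => (hl 1 x).trans (hg₁ x)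
  simpa only [e1, e2, e3, e4] using hc

end Homology

/-! ### Homotopy extension for the cube and its boundary -/

section HomotopyExtension

/-- The vector `2t - 1 ∈ [-1, 1]⁴`, with the maximum norm. -/
def cubeCentered (t : I^ (Fin 4)) : Fin 4 → ℝ := fun i => 2 * (t i : ℝ) - 1

/-- The retraction of `ℝ⁴` onto the cube, in the coordinates `2t - 1`. -/
def cubeClamp (y : Fin 4 → ℝ) : I^ (Fin 4) := fun i =>
  Set.projIcc 0 1 zero_le_one ((y i + 1) / 2)

theorem continuous_cubeCentered : Continuous cubeCentered := by
  unfold cubeCentered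
  fun_prop

theorem continuous_cubeClamp : Continuous cubeClamp :=
  continuous_pi fun i => continuous_projIcc.comp (by fun_prop)

theorem cubeClamp_cubeCentered (t : I^ (Fin 4)) : cubeClamp (cubeCentered t) = t := by
  funext i
  have h : (2 * (t i : ℝ) - 1 + 1) / 2 = t i := by ring
  simp only [cubeClamp, cubeCentered, h]
  exact Set.projIcc_val zero_le_one (t i)

theorem norm_cubeCentered_le (t : I^ (Fin 4)) : ‖cubeCentered t‖ ≤ 1 := by
  refine (pi_norm_le_iff_of_nonneg zero_le_one).2 fun i => abs_le.2 ⟨?_, ?_⟩ <;>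
    simp only [cubeCentered] <;> linarith [(t i).2.1, (t i).2.2]

theorem norm_cubeCentered_of_mem_boundary {t : I^ (Fin 4)} (ht : t ∈ Cube.boundary (Fin 4)) :
    ‖cubeCentered t‖ = 1 := by
  refine le_antisymm (norm_cubeCentered_le t) ?_
  obtain ⟨i, hi⟩ := ht
  refine le_trans (le_of_eq ?_) (norm_le_pi_norm (cubeCentered t) i)
  rcases hi with h | h <;> simp only [cubeCentered, h] <;> norm_num

theorem cubeClamp_mem_boundary {y : Fin 4 → ℝ} (hy : ‖y‖ = 1) :
    cubeClamp y ∈ Cube.boundary (Fin 4) := by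
  obtain ⟨i, -, hi⟩ := (Finset.univ : Finset (Fin 4)).exists_max_image (fun i => ‖y i‖)
    Finset.univ_nonempty
  have h1 : |y i| = 1 := by
    refine le_antisymm ((norm_le_pi_norm y i).trans hy.le) (hy.symm.le.trans ?_)
    exact (pi_norm_le_iff_of_nonneg (norm_nonneg _)).2 fun j => hi j (Finset.mem_univ j)
  rcases eq_or_eq_neg_of_abs_eq h1 with h | h
  · refine ⟨i, Or.inr (Set.projIcc_of_right_le _ ?_)⟩
    rw [h]; norm_num
  · refine ⟨i, Or.inl (Set.projIcc_of_le_left _ ?_)⟩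
    rw [h]; norm_num

/-- The homotopy extension property of the pair `(I⁴, ∂I⁴)`. -/
theorem cube_homotopy_extension {X : Type} [TopologicalSpace X] (f : C(I^ (Fin 4), X))
    (h : I × (I^ (Fin 4)) → X) (hc : ContinuousOn h {p | p.2 ∈ Cube.boundary (Fin 4)})
    (h0 : ∀ t ∈ Cube.boundary (Fin 4), h (0, t) = f t) :
    ∃ F : C(I × (I^ (Fin 4)), X), (∀ t, F (0, t) = f t) ∧
      ∀ s, ∀ t ∈ Cube.boundary (Fin 4), F (s, t) = h (s, t) := by
  classical
  -- At time `s` the centered cube is magnified by `1 + s`. The part still inside the original cube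
  -- carries `f`; the part outside, a collar of width `s`, carries `h`, with the excess radius `r -
  -- 1` as time and the radial projection to the boundary as position.
  let r : I × (I^ (Fin 4)) → ℝ := fun p => (1 + (p.1 : ℝ)) * ‖cubeCentered p.2‖
  let F : I × (I^ (Fin 4)) → X := fun p =>
    if r p ≤ 1 then f (cubeClamp ((1 + (p.1 : ℝ)) • cubeCentered p.2))
    else h (Set.projIcc 0 1 zero_le_one (r p - 1),
      cubeClamp (‖cubeCentered p.2‖⁻¹ • cubeCentered p.2))
  have hcc : Continuous fun p : I × (I^ (Fin 4)) => cubeCentered p.2 :=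
    continuous_cubeCentered.comp continuous_snd
  have hs : Continuous fun p : I × (I^ (Fin 4)) => 1 + (p.1 : ℝ) := by fun_prop
  have hr : Continuous r := hs.mul hcc.norm
  have hne : ∀ p : I × (I^ (Fin 4)), 1 ≤ r p → ‖cubeCentered p.2‖ ≠ 0 := fun p hp hz => by
    have : r p = 0 := by simp only [r, hz, mul_zero]
    linarith
  have hF : Continuous F := by
    refine continuous_if_le hr continuous_const
      (f.continuous.comp (continuous_cubeClamp.comp (hs.smul hcc))).continuousOn ?_ ?_
    · refine hc.comp (ContinuousOn.prodMk
        (continuous_projIcc.comp (hr.sub continuous_const)).continuousOn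
        (continuous_cubeClamp.comp_continuousOn
          ((hcc.norm.continuousOn.inv₀ hne).smul hcc.continuousOn))) fun p hp => ?_
      refine cubeClamp_mem_boundary ?_
      rw [norm_smul, norm_inv, norm_norm, inv_mul_cancel₀ (hne p hp)]
    · intro p hp
      have hn := hne p hp.ge
      have h1 : 1 + (p.1 : ℝ) = ‖cubeCentered p.2‖⁻¹ := eq_inv_of_mul_eq_one_left hp
      have h2 : Set.projIcc (0 : ℝ) 1 zero_le_one (r p - 1) = 0 :=
        Set.projIcc_of_le_left _ (by rw [hp, sub_self])
      rw [h1, h2, h0 _ (cubeClamp_mem_boundary ?_)]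
      rw [norm_smul, norm_inv, norm_norm, inv_mul_cancel₀ hn]
  refine ⟨⟨F, hF⟩, fun t => ?_, fun s t ht => ?_⟩
  · have hle : r (0, t) ≤ 1 := by
      simpa only [r, Set.Icc.coe_zero, add_zero, one_mul] using norm_cubeCentered_le t
    change (if r (0, t) ≤ 1 then _ else _) = _
    rw [if_pos hle]
    simp only [Set.Icc.coe_zero, add_zero, one_smul, cubeClamp_cubeCentered]
  · have hn := norm_cubeCentered_of_mem_boundary ht
    have hrs : r (s, t) = 1 + s := by simp only [r, hn, mul_one]
    change (if r (s, t) ≤ 1 then _ else _) = _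
    split_ifs with hle
    -- On the boundary `r = 1 + s`, so the inner branch is met only at time `0`.
    · have hs0 : s = 0 := Subtype.ext (le_antisymm (by rw [hrs] at hle; simpa using hle) s.2.1)
      subst hs0
      simp only [Set.Icc.coe_zero, add_zero, one_smul, cubeClamp_cubeCentered, h0 t ht]
    · have h2 : Set.projIcc (0 : ℝ) 1 zero_le_one (r (s, t) - 1) = s := by
        rw [hrs, add_sub_cancel_left]
        exact Set.projIcc_val zero_le_one s
      simp only [h2, hn, inv_one, one_smul, cubeClamp_cubeCentered]

/-- Every map from the cube to a path connected space is homotopic to every constant map. -/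
theorem cube_homotopic_const {X : Type} [TopologicalSpace X] [PathConnectedSpace X]
    (f : C(I^ (Fin 4), X)) (x : X) : f.Homotopic (ContinuousMap.const _ x) := by
  -- The cube is scaled down to its vertex `0`; a path in `X` then moves the value there to `x`.
  have h1 : f.Homotopic (ContinuousMap.const _ (f 0)) :=
    ⟨{ toFun := fun p => f fun i => unitInterval.symm p.1 * p.2 i
       continuous_toFun := f.continuous.comp (by fun_prop)
       map_zero_left := fun t => by simp
       map_one_left := fun t => by
        simp only [unitInterval.symm_one, zero_mul]
        rfl }⟩
  obtain ⟨γ⟩ := PathConnectedSpace.joined (f 0) x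
  exact h1.trans
    ⟨{ toFun := fun p => γ p.1
       continuous_toFun := γ.continuous.comp continuous_fst
       map_zero_left := fun t => γ.source
       map_one_left := fun t => γ.target }⟩

end HomotopyExtension

/-! ### The unit sphere of the quaternion plane and its free action -/

section UnitSphere

/-- The point `(1, 0)` of `U(ℍ²)`. -/
def poleVec : UnitH2 := ⟨(1, 0), by simp⟩

/-- The norm of `ℍ × ℍ` is the maximum norm, so `UnitH2` is not its metric sphere. It is instead the
image of the punctured space under Euclidean normalization. -/
instance : PathConnectedSpace UnitH2 := by
  have hrank : 1 < Module.rank ℝ (ℍ × ℍ) := by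
    rw [← Module.finrank_eq_rank, Module.finrank_prod, Quaternion.finrank_eq_four]
    norm_num
  have hpc := isPathConnected_iff_pathConnectedSpace.1
    (isPathConnected_compl_singleton_of_one_lt_rank hrank 0)
  have hpos : ∀ w : ({0}ᶜ : Set (ℍ × ℍ)), 0 < ‖w.1.1‖ ^ 2 + ‖w.1.2‖ ^ 2 := fun w => by
    by_contra hn
    have h1 : ‖w.1.1‖ ^ 2 = 0 := by nlinarith [sq_nonneg ‖w.1.1‖, sq_nonneg ‖w.1.2‖]
    have h2 : ‖w.1.2‖ ^ 2 = 0 := by nlinarith [sq_nonneg ‖w.1.1‖, sq_nonneg ‖w.1.2‖]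
    exact w.2 (Prod.ext (by simpa using h1) (by simpa using h2))
  let N : ({0}ᶜ : Set (ℍ × ℍ)) → ℝ := fun w => Real.sqrt (‖w.1.1‖ ^ 2 + ‖w.1.2‖ ^ 2)
  have hN : ∀ w, 0 < N w := fun w => Real.sqrt_pos.2 (hpos w)
  let φ : ({0}ᶜ : Set (ℍ × ℍ)) → UnitH2 := fun w =>
    ⟨((N w)⁻¹ • w.1.1, (N w)⁻¹ • w.1.2), by
      have h : N w ^ 2 = ‖w.1.1‖ ^ 2 + ‖w.1.2‖ ^ 2 := Real.sq_sqrt (hpos w).le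
      simp only [norm_smul, mul_pow, norm_inv, Real.norm_eq_abs, sq_abs, inv_pow]
      rw [← mul_add, ← h, inv_mul_cancel₀ (pow_ne_zero 2 (hN w).ne')]⟩
  have hNc : Continuous N := by fun_prop
  have hφ : Continuous φ := by
    have hi := hNc.inv₀ fun w => (hN w).ne'
    exact ((hi.smul (continuous_fst.comp continuous_subtype_val)).prodMk
      (hi.smul (continuous_snd.comp continuous_subtype_val))).subtype_mk _
  refine Function.Surjective.pathConnectedSpace (f := φ) (fun v => ?_) hφ
  refine ⟨⟨v.1, fun h0 => ?_⟩, Subtype.ext ?_⟩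
  · have h := v.2
    rw [Set.mem_singleton_iff.1 h0] at h
    simp at h
  · have h1 : N ⟨v.1, fun h0 => by
        have h := v.2
        rw [Set.mem_singleton_iff.1 h0] at h
        simp at h⟩ = 1 := by
      change Real.sqrt (‖v.1.1‖ ^ 2 + ‖v.1.2‖ ^ 2) = 1
      rw [v.2, Real.sqrt_one]
    change ((N _)⁻¹ • v.1.1, (N _)⁻¹ • v.1.2) = v.1
    rw [h1, inv_one, one_smul, one_smul]

theorem smul_val (g : SU2) (v : UnitH2) :
    (g • v).1 = (v.1.1 * ((g⁻¹ : SU2) : ℍ), v.1.2 * ((g⁻¹ : SU2) : ℍ)) := rfl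

instance : ContinuousConstSMul SU2 UnitH2 where
  continuous_const_smul _ :=
    (((continuous_fst.comp continuous_subtype_val).mul continuous_const).prodMk
      ((continuous_snd.comp continuous_subtype_val).mul continuous_const)).subtype_mk _

/-- The unit quaternion in the direction of `q`, and `1` if `q = 0`. -/
def toSU2 (q : ℍ) : SU2 :=
  open Classical in
  if h : q = 0 then 1 else ⟨‖q‖⁻¹ • q, mem_sphere_zero_iff_norm.2 (by
    rw [norm_smul, norm_inv, norm_norm, inv_mul_cancel₀ (norm_ne_zero_iff.2 h)])⟩

theorem toSU2_val {q : ℍ} (h : q ≠ 0) : (toSU2 q : ℍ) = ‖q‖⁻¹ • q := by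
  rw [toSU2, dif_neg h]

theorem toSU2_coe (g : SU2) : toSU2 (g : ℍ) = g := by
  have hn := norm_su2 g
  refine Subtype.ext ?_
  rw [toSU2_val (norm_ne_zero_iff.1 (by rw [hn]; exact one_ne_zero)), hn, inv_one, one_smul]

theorem continuousAt_toSU2 {q : ℍ} (h : q ≠ 0) : ContinuousAt toSU2 q := by
  rw [Topology.IsInducing.subtypeVal.continuousAt_iff]
  have h1 : ContinuousAt (fun q : ℍ => ‖q‖⁻¹ • q) q :=
    (continuous_norm.continuousAt.inv₀ (norm_ne_zero_iff.2 h)).smul continuousAt_id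
  refine h1.congr ?_
  filter_upwards [isOpen_ne.mem_nhds h] with q' hq'
  exact (toSU2_val hq').symm

/-- The pairing `v̄₁ w₁ + v̄₂ w₂` of `U(ℍ²)`. -/
def pairing (v w : UnitH2) : ℍ := star v.1.1 * w.1.1 + star v.1.2 * w.1.2

theorem continuous_pairing : Continuous fun p : UnitH2 × UnitH2 => pairing p.1 p.2 := by
  have h1 : Continuous fun p : UnitH2 × UnitH2 => p.1.1 :=
    continuous_subtype_val.comp continuous_fst
  have h2 : Continuous fun p : UnitH2 × UnitH2 => p.2.1 :=
    continuous_subtype_val.comp continuous_snd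
  exact (h1.fst.star.mul h2.fst).add (h1.snd.star.mul h2.snd)

/-- The pairing recovers the group element that carries one point of an orbit to another, and does
so continuously. This gives freeness of the action and continuity of fibre coordinates. -/
theorem pairing_smul (g : SU2) (w : UnitH2) : pairing (g • w) w = g := by
  have hg : star ((g⁻¹ : SU2) : ℍ) = g := by
    have h1 : star ((g⁻¹ : SU2) : ℍ) * ((g⁻¹ : SU2) : ℍ) = 1 := by
      rw [Quaternion.star_mul_self, Quaternion.normSq_eq_norm_mul_self, norm_su2, mul_one,
        Quaternion.coe_one]
    have h2 : ((g⁻¹ : SU2) : ℍ) * (g : ℍ) = 1 := by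
      rw [← Metric.unitSphere.coe_mul, inv_mul_cancel, Metric.unitSphere.coe_one]
    rw [← mul_one (star _), ← h2, ← mul_assoc, h1, one_mul]
  have hw : star w.1.1 * w.1.1 + star w.1.2 * w.1.2 = 1 := by
    rw [Quaternion.star_mul_self, Quaternion.star_mul_self, Quaternion.normSq_eq_norm_mul_self,
      Quaternion.normSq_eq_norm_mul_self, ← sq, ← sq, ← Quaternion.coe_add, w.2,
      Quaternion.coe_one]
  rw [pairing, smul_val]
  simp only [star_mul, hg]
  rw [mul_assoc, mul_assoc, ← mul_add, hw, mul_one]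

theorem pairing_self (w : UnitH2) : pairing w w = 1 := by
  have h := pairing_smul 1 w
  rwa [one_smul] at h

theorem eq_one_of_smul_eq {g : SU2} {w : UnitH2} (h : g • w = w) : g = 1 := by
  have h1 := pairing_smul g w
  rw [h, pairing_self] at h1
  exact Subtype.ext h1.symm

end UnitSphere

/-! ### Fibre coordinates in the associated bundle -/

section Bundle

variable {M : Type} [MulAction SU2 M]

theorem totalPt_smul (g : SU2) (v : UnitH2) (x : M) : totalPt (g • v) (g • x) = totalPt v x :=
  Quotient.sound ⟨g, rfl⟩

theorem exists_smul_of_totalPt_eq {v w : UnitH2} {x y : M} (h : totalPt v x = totalPt w y) :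
    ∃ g : SU2, g • w = v ∧ g • y = x := by
  obtain ⟨g, hg⟩ := Quotient.exact h
  exact ⟨g, congrArg Prod.fst hg, congrArg Prod.snd hg⟩

theorem totalPt_injective {v : UnitH2} {x y : M} (h : totalPt v x = totalPt v y) : x = y := by
  obtain ⟨g, hg, hx⟩ := exists_smul_of_totalPt_eq h
  rw [← hx, eq_one_of_smul_eq hg, one_smul]

theorem exists_totalPt_of_proj_eq {e : TotalSpace M} {v : UnitH2} (h : proj e = basePt v) :
    ∃ x : M, e = totalPt v x := by
  induction e using Quotient.inductionOn with
  | h p =>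
    obtain ⟨g, hg⟩ := Quotient.exact (h : basePt p.1 = basePt v)
    have hg' : g • v = p.1 := hg
    refine ⟨g⁻¹ • p.2, ?_⟩
    rw [← totalPt_smul g, smul_inv_smul, hg']
    rfl

/-- Here `v = (q, 0)` is the right translate of `(1, 0)` by the unit quaternion `q`. This is the
source of the clutching map. -/
theorem totalPt_of_snd_eq_zero {v : UnitH2} (hv : v.1.2 = 0) (x : M) :
    totalPt v ((toSU2 v.1.1)⁻¹ • x) = totalPt poleVec x := by
  have h1 : ‖v.1.1‖ = 1 := by
    have h := v.2
    rw [hv, norm_zero] at h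
    nlinarith [norm_nonneg v.1.1]
  have h2 : (toSU2 v.1.1 : ℍ) = v.1.1 := by
    rw [toSU2_val (norm_ne_zero_iff.1 (by rw [h1]; exact one_ne_zero)), h1, inv_one, one_smul]
  rw [← totalPt_smul (toSU2 v.1.1)⁻¹ poleVec]
  congr 1
  refine Subtype.ext ?_
  rw [smul_val, inv_inv, h2]
  change v.1 = (1 * v.1.1, 0 * v.1.1)
  rw [one_mul, zero_mul, ← hv]

variable [TopologicalSpace M]

theorem continuous_totalPt : Continuous fun p : UnitH2 × M => totalPt p.1 p.2 :=
  continuous_quot_mk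

/-- A map into the total space whose projection lifts to `U(ℍ²)` has a continuous
fibre coordinate. -/
theorem exists_fiber_coordinate (hc : Continuous fun p : SU2 × M => p.1 • p.2)
    {T : Type} [TopologicalSpace T] (v : C(T, UnitH2)) (p : C(T, TotalSpace M))
    (h : ∀ t, proj (p t) = basePt (v t)) :
    ∃ f : C(T, M), ∀ t, p t = totalPt (v t) (f t) := by
  have : ContinuousConstSMul SU2 M := ⟨fun g => hc.comp (Continuous.prodMk_right g)⟩
  choose f hf using fun t => exists_totalPt_of_proj_eq (h t)
  refine ⟨⟨f, continuous_iff_continuousAt.2 fun t₀ => ?_⟩, hf⟩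
  -- `D` computes the fibre coordinate over `v t` from any representative `(w, x)` of `p t`; `toSU2`
  -- makes it defined also off the orbit relation.
  let D : UnitH2 × (UnitH2 × M) → M := fun q => toSU2 (pairing q.1 q.2.1) • q.2.2
  have hD : ContinuousAt D (v t₀, (v t₀, f t₀)) := by
    have h1 : ContinuousAt (fun q : UnitH2 × (UnitH2 × M) => pairing q.1 q.2.1)
        (v t₀, (v t₀, f t₀)) :=
      (continuous_pairing.comp
        (continuous_fst.prodMk (continuous_fst.comp continuous_snd))).continuousAt
    have h2 : ContinuousAt toSU2 (pairing (v t₀) (v t₀)) :=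
      continuousAt_toSU2 (by rw [pairing_self]; exact one_ne_zero)
    have h3 : ContinuousAt (fun q : UnitH2 × (UnitH2 × M) => toSU2 (pairing q.1 q.2.1))
        (v t₀, (v t₀, f t₀)) := h2.comp_of_eq h1 rfl
    exact hc.continuousAt.comp (h3.prodMk
      (continuous_snd.comp continuous_snd).continuousAt)
  have hD0 : D (v t₀, (v t₀, f t₀)) = f t₀ := by
    change toSU2 (pairing (v t₀) (v t₀)) • f t₀ = f t₀
    rw [pairing_self, ← Metric.unitSphere.coe_one, toSU2_coe, one_smul]
  have hDeq : ∀ t w x, p t = totalPt w x → D (v t, (w, x)) = f t := fun t w x hp => by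
    obtain ⟨g, hg, hx⟩ := exists_smul_of_totalPt_eq ((hf t).symm.trans hp)
    change toSU2 (pairing (v t) w) • x = f t
    rw [← hg, pairing_smul, toSU2_coe, hx]
  intro N hN
  rw [← hD0] at hN
  have hpre := hD hN
  rw [Filter.mem_map, nhds_prod_eq, Filter.mem_prod_iff] at hpre
  obtain ⟨A, hA, B, hB, hAB⟩ := hpre
  -- Since the orbit map is open, `p t` has a representative near `(v t₀, f t₀)` for `t` near `t₀`;
  -- `D` needs only some such representative, not a continuous choice.
  have hopen : IsOpenMap fun q : UnitH2 × M => totalPt q.1 q.2 :=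
    isOpenMap_quotient_mk'_mul
  have himg := hopen.image_mem_nhds hB
  change _ ∈ 𝓝 (totalPt (v t₀) (f t₀)) at himg
  rw [← hf t₀] at himg
  change ∀ᶠ t in 𝓝 t₀, f t ∈ N
  filter_upwards [v.continuous.continuousAt hA, p.continuous.continuousAt himg] with t h1 h2
  obtain ⟨⟨w, x⟩, hwx, hp⟩ := h2
  have h3 : D (v t, (w, x)) ∈ N := hAB (Set.mk_mem_prod h1 hwx)
  rwa [hDeq t w x hp.symm] at h3

end Bundle

/-! ### Equivariant sections and fixed points -/

variable {M : Type} [MulAction SU2 M] [TopologicalSpace M]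

theorem exists_equivariant_section_iff :
    (∃ s : C(S4, TotalSpace M), IsSection s ∧ IsEquivariant s) ↔
      ∃ x : M, ∀ g : SU2, g • x = x := by
  constructor
  · rintro ⟨s, hs, he⟩
    obtain ⟨x, hx⟩ := exists_totalPt_of_proj_eq (v := poleVec) (hs pole)
    refine ⟨x, fun g => ?_⟩
    -- The first coordinate of `poleVec` is `1`, so left and right multiplication by `g` have the
    -- same effect.
    have hrot : rot g⁻¹ poleVec = g⁻¹ • poleVec := Subtype.ext (by
      change (((g⁻¹⁻¹ : SU2) : ℍ) * 1, (0 : ℍ)) =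
        ((1 : ℍ) * ((g⁻¹⁻¹ : SU2) : ℍ), (0 : ℍ) * ((g⁻¹⁻¹ : SU2) : ℍ))
      rw [mul_one, one_mul, zero_mul])
    have h1 : rotBase g⁻¹ pole = pole := by
      change basePt (rot g⁻¹ poleVec) = basePt poleVec
      exact basePt_eq g⁻¹ hrot.symm
    have h2 := he g⁻¹ pole
    rw [h1, hx] at h2
    change totalPt poleVec x = totalPt (rot g⁻¹ poleVec) x at h2
    rw [hrot] at h2
    have h3 := totalPt_smul g⁻¹ poleVec (g • x)
    rw [inv_smul_smul, ← h2] at h3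
    exact (totalPt_injective h3).symm
  · rintro ⟨x, hx⟩
    let τ : S4 → TotalSpace M := Quotient.lift (fun v => totalPt v x) (by
      rintro v w ⟨g, hg⟩
      have hg' : g • w = v := hg
      have h := totalPt_smul g w x
      rwa [hx g, hg'] at h)
    have hτ : Continuous τ :=
      Continuous.quotient_lift (continuous_totalPt.comp (Continuous.prodMk_left x)) _
    exact ⟨⟨τ, hτ⟩, fun b => Quotient.inductionOn b fun _ => rfl,
      fun h b => Quotient.inductionOn b fun _ => rfl⟩

/-! ### Homology classes of sections -/

theorem hurewiczLoop_eq_differenceClass {X : Type} [TopologicalSpace X] {x : X}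
    (f : GenLoop (Fin 4) X x) :
    hurewiczLoop f = differenceClass (f.1.comp simplexToCube) (ContinuousMap.const _ x)
      fun y hy => GenLoop.boundary f _ (simplexToCube_boundary y hy) := by
  have h0 : ofGenLoop f (collapse 0) = x := GenLoop.boundary f 0 zero_mem_boundary
  have h1 : (ofGenLoop f).comp (ContinuousMap.const (stdSimplex ℝ (Fin 5)) (collapse 0)) =
      ContinuousMap.const _ x := ContinuousMap.ext fun _ => h0
  exact (H4map_differenceClass (ofGenLoop f) _).trans (differenceClass_congr rfl h1 _ _)

/-- The image of a generalized loop under a continuous map. -/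
def mapGenLoop {X Y : Type} [TopologicalSpace X] [TopologicalSpace Y] (φ : C(X, Y)) {x : X}
    (f : GenLoop (Fin 4) X x) : GenLoop (Fin 4) Y (φ x) :=
  ⟨φ.comp f.1, fun t ht => congrArg φ (f.2 t ht)⟩

theorem H4map_hurewiczLoop {X Y : Type} [TopologicalSpace X] [TopologicalSpace Y] (φ : C(X, Y))
    {x : X} (f : GenLoop (Fin 4) X x) :
    H4map φ (hurewiczLoop f) = hurewiczLoop (mapGenLoop φ f) := by
  rw [hurewiczLoop_eq_differenceClass, hurewiczLoop_eq_differenceClass]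
  exact H4map_differenceClass φ _

theorem H4map_hurewiczLoop_eq_differenceClass {X Y : Type} [TopologicalSpace X]
    [TopologicalSpace Y] (φ : C(X, Y)) {x : X} (f : GenLoop (Fin 4) X x) (k : C(I^ (Fin 4), Y))
    (y : Y) (hk : ∀ t, φ (f t) = k t) (hy : φ x = y)
    (h : ∀ z : stdSimplex ℝ (Fin 5), (∃ i, z i = 0) →
      k.comp simplexToCube z = ContinuousMap.const (stdSimplex ℝ (Fin 5)) y z) :
    H4map φ (hurewiczLoop f) =
      differenceClass (k.comp simplexToCube) (ContinuousMap.const _ y) h := by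
  rw [H4map_hurewiczLoop, hurewiczLoop_eq_differenceClass]
  exact differenceClass_congr (ContinuousMap.ext fun z => hk _)
    (congrArg (ContinuousMap.const _) hy) _ _

theorem cubeUnit_snd_eq_zero {t : I^ (Fin 4)} (ht : t ∈ Cube.boundary (Fin 4)) :
    (cubeUnit t).1.2 = 0 := by
  change (cubeNorm t)⁻¹ • (cubeBump t : ℍ) = 0
  rw [(cubeBump_eq_zero_iff t).2 ht, Quaternion.coe_zero, smul_zero]

theorem cubeUnit_fst_ne_zero {t : I^ (Fin 4)} (ht : t ∈ Cube.boundary (Fin 4)) :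
    (cubeUnit t).1.1 ≠ 0 := fun h => by
  have h1 := (cubeUnit t).2
  rw [h, cubeUnit_snd_eq_zero ht] at h1
  simp at h1

/-- The clutching map `∂I⁴ → SU(2)`. -/
def cubeClutch (t : I^ (Fin 4)) : SU2 := toSU2 (cubeUnit t).1.1

/-- Continuity is claimed only on the boundary: the first coordinate of `cubeUnit` vanishes at the
centre of the cube. -/
theorem continuousOn_cubeClutch : ContinuousOn cubeClutch (Cube.boundary (Fin 4)) := fun _ ht =>
  ((continuousAt_toSU2 (cubeUnit_fst_ne_zero ht)).comp_of_eq
    (continuous_subtype_val.comp continuous_cubeUnit).fst.continuousAt rfl).continuousWithinAt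

omit [TopologicalSpace M] in
theorem totalPt_cubeUnit {t : I^ (Fin 4)} (ht : t ∈ Cube.boundary (Fin 4)) (x : M) :
    totalPt (cubeUnit t) ((cubeClutch t)⁻¹ • x) = totalPt poleVec x :=
  totalPt_of_snd_eq_zero (cubeUnit_snd_eq_zero ht) x

/-- The map `t ↦ [v t, f t]` into the total space. -/
def totalMap {T : Type} [TopologicalSpace T] (v : C(T, UnitH2)) (f : C(T, M)) :
    C(T, TotalSpace M) :=
  ⟨fun t => totalPt (v t) (f t), continuous_totalPt.comp (v.continuous.prodMk f.continuous)⟩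

/-- The lift of the cube to `U(ℍ²)`. -/
def cubeLift : C(I^ (Fin 4), UnitH2) := ⟨cubeUnit, continuous_cubeUnit⟩

/-- In the trivialization over the cube, a section is a map to the fibre whose restriction to
the boundary is the orbit map of a point. -/
theorem exists_section_coordinate (hc : Continuous fun p : SU2 × M => p.1 • p.2)
    {s : C(S4, TotalSpace M)} (hs : IsSection s) :
    ∃ (f : C(I^ (Fin 4), M)) (y : M), (∀ t, s (cubeToS4 t) = totalPt (cubeUnit t) (f t)) ∧
      s pole = totalPt poleVec y ∧
      ∀ t ∈ Cube.boundary (Fin 4), f t = (cubeClutch t)⁻¹ • y := by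
  obtain ⟨f, hf⟩ := exists_fiber_coordinate hc cubeLift (s.comp cubeToS4.1) fun t => hs _
  obtain ⟨y, hy⟩ := exists_totalPt_of_proj_eq (v := poleVec) (hs pole)
  refine ⟨f, y, hf, hy, fun t ht => totalPt_injective (v := cubeUnit t) ?_⟩
  rw [totalPt_cubeUnit ht, ← hy, ← GenLoop.boundary cubeToS4 t ht]
  exact (hf t).symm

theorem H4map_section_eq {s : C(S4, TotalSpace M)} {f : C(I^ (Fin 4), M)} {y : M}
    (hf : ∀ t, s (cubeToS4 t) = totalPt (cubeUnit t) (f t)) (hy : s pole = totalPt poleVec y)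
    (h : ∀ x : stdSimplex ℝ (Fin 5), (∃ i, x i = 0) →
      (totalMap cubeLift f).comp simplexToCube x =
        ContinuousMap.const (stdSimplex ℝ (Fin 5)) (totalPt poleVec y) x) :
    H4map s fundamentalClass =
      differenceClass ((totalMap cubeLift f).comp simplexToCube)
        (ContinuousMap.const _ (totalPt poleVec y)) h :=
  H4map_hurewiczLoop_eq_differenceClass s cubeToS4 (totalMap cubeLift f) _ hf hy h

/-- The homology class of a section in terms of a fibre coordinate whose boundary values have
been moved to those of any other point of the fibre. -/
theorem exists_section_coordinate_of_joined (hc : Continuous fun p : SU2 × M => p.1 • p.2)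
    {s : C(S4, TotalSpace M)} {f : C(I^ (Fin 4), M)} {y z : M} (γ : Path y z)
    (hf : ∀ t, s (cubeToS4 t) = totalPt (cubeUnit t) (f t)) (hy : s pole = totalPt poleVec y)
    (hb : ∀ t ∈ Cube.boundary (Fin 4), f t = (cubeClutch t)⁻¹ • y) :
    ∃ (f' : C(I^ (Fin 4), M)) (_ : ∀ t ∈ Cube.boundary (Fin 4), f' t = (cubeClutch t)⁻¹ • z)
      (h : ∀ x : stdSimplex ℝ (Fin 5), (∃ i, x i = 0) →
        (totalMap cubeLift f').comp simplexToCube x =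
          ContinuousMap.const (stdSimplex ℝ (Fin 5)) (totalPt poleVec z) x),
      H4map s fundamentalClass =
        differenceClass ((totalMap cubeLift f').comp simplexToCube)
          (ContinuousMap.const _ (totalPt poleVec z)) h := by
  have hinv : ContinuousOn (fun p : I × (I^ (Fin 4)) => (cubeClutch p.2)⁻¹)
      {p | p.2 ∈ Cube.boundary (Fin 4)} :=
    (continuousOn_cubeClutch.comp continuous_snd.continuousOn fun _ hp => hp).inv
  -- With these boundary values, at time `s` the whole of `∂I⁴` is sent to the single point `[(1,
  -- 0), γ s]` of the total space, so the constant simplex can move along with `F`.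
  obtain ⟨F, hF0, hFb⟩ := cube_homotopy_extension f
    (fun p => (cubeClutch p.2)⁻¹ • γ p.1)
    (hc.comp_continuousOn (hinv.prodMk (γ.continuous.comp continuous_fst).continuousOn))
    fun t ht => by rw [γ.source, hb t ht]
  have hF1 : ∀ t ∈ Cube.boundary (Fin 4), F (1, t) = (cubeClutch t)⁻¹ • z := fun t ht => by
    rw [hFb 1 t ht, γ.target]
  have hend : ∀ {k : C(I^ (Fin 4), M)} {w : M},
      (∀ t ∈ Cube.boundary (Fin 4), k t = (cubeClutch t)⁻¹ • w) →
      ∀ x : stdSimplex ℝ (Fin 5), (∃ i, x i = 0) →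
        (totalMap cubeLift k).comp simplexToCube x =
          ContinuousMap.const (stdSimplex ℝ (Fin 5)) (totalPt poleVec w) x := by
    intro k w hk x hx
    have ht := simplexToCube_boundary x hx
    change totalPt (cubeUnit _) (k _) = totalPt poleVec w
    rw [hk _ ht, totalPt_cubeUnit ht]
  let f' : C(I^ (Fin 4), M) := ⟨fun t => F (1, t), F.continuous.comp (Continuous.prodMk_right 1)⟩
  have hf' : ∀ t ∈ Cube.boundary (Fin 4), f' t = (cubeClutch t)⁻¹ • z := hF1
  refine ⟨f', hf', hend hf', ?_⟩
  rw [H4map_section_eq hf hy (hend hb)]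
  refine differenceClass_homotopy
    ⟨fun p => totalPt (cubeUnit (simplexToCube p.2)) (F (p.1, simplexToCube p.2)),
      continuous_totalPt.comp ((continuous_cubeUnit.comp
        (simplexToCube.continuous.comp continuous_snd)).prodMk (F.continuous.comp
          (continuous_fst.prodMk (simplexToCube.continuous.comp continuous_snd))))⟩
    ⟨fun p => totalPt poleVec (γ p.1), continuous_totalPt.comp
      (continuous_const.prodMk (γ.continuous.comp continuous_fst))⟩
    (fun s' x hx => ?_) (fun x => ?_) (fun x => ?_) (fun x => rfl) (fun x => ?_) _ _
  · have ht := simplexToCube_boundary x hx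
    change totalPt (cubeUnit _) (F _) = totalPt poleVec (γ s')
    rw [hFb s' _ ht, totalPt_cubeUnit ht]
  · exact congrArg (totalPt (cubeUnit (simplexToCube x))) (hF0 _)
  · exact congrArg (totalPt poleVec) γ.source
  · exact congrArg (totalPt poleVec) γ.target

/-- Two maps from the cube to a path connected fibre that agree on the boundary have, in the
total space, a difference class that comes from the fourth homotopy group of the fibre. -/
theorem differenceClass_mem_range_hurewicz [PathConnectedSpace M] (u : C(I^ (Fin 4), UnitH2))
    (f g : C(I^ (Fin 4), M)) (hfg : ∀ t ∈ Cube.boundary (Fin 4), f t = g t)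
    (h : ∀ x : stdSimplex ℝ (Fin 5), (∃ i, x i = 0) →
      (totalMap u f).comp simplexToCube x = (totalMap u g).comp simplexToCube x)
    (v : UnitH2) (m : M) :
    differenceClass ((totalMap u f).comp simplexToCube) ((totalMap u g).comp simplexToCube) h ∈
      Set.range (fun α : π_ 4 M m => hurewicz (pi4map (fiberIncl v) m α)) := by
  obtain ⟨U⟩ := cube_homotopic_const u v
  obtain ⟨W⟩ := cube_homotopic_const g m
  -- `F` follows the contraction `W` of `g` on the boundary, so the two maps agree there at all
  -- times, and at time `1` the boundary is sent to `m`.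
  obtain ⟨F, hF0, hFb⟩ := cube_homotopy_extension f W W.continuous.continuousOn
    fun t ht => by rw [hfg t ht]; exact W.apply_zero t
  let α : GenLoop (Fin 4) M m :=
    ⟨⟨fun t => F (1, t), F.continuous.comp (Continuous.prodMk_right 1)⟩,
      fun t ht => (hFb 1 t ht).trans (W.apply_one t)⟩
  refine ⟨Quotient.mk _ α, ?_⟩
  change hurewiczLoop (mapGenLoop (fiberIncl v) α) = _
  rw [hurewiczLoop_eq_differenceClass]
  have hq : Continuous fun p : I × stdSimplex ℝ (Fin 5) => (p.1, simplexToCube p.2) :=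
    continuous_fst.prodMk (simplexToCube.continuous.comp continuous_snd)
  symm
  refine differenceClass_homotopy
    ⟨fun p => totalPt (U (p.1, simplexToCube p.2)) (F (p.1, simplexToCube p.2)),
      continuous_totalPt.comp ((U.continuous.comp hq).prodMk (F.continuous.comp hq))⟩
    ⟨fun p => totalPt (U (p.1, simplexToCube p.2)) (W (p.1, simplexToCube p.2)),
      continuous_totalPt.comp ((U.continuous.comp hq).prodMk (W.continuous.comp hq))⟩
    (fun s x hx => ?_) (fun x => ?_) (fun x => ?_) (fun x => ?_) (fun x => ?_) _ _
  · exact congrArg (totalPt (U (s, simplexToCube x))) (hFb s _ (simplexToCube_boundary x hx))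
  · exact congrArg₂ totalPt (U.apply_zero _) (hF0 _)
  · exact congrArg₂ totalPt (U.apply_zero _) (W.apply_zero _)
  · exact congrArg₂ totalPt (U.apply_one _) rfl
  · exact congrArg₂ totalPt (U.apply_one _) (W.apply_one _)

theorem H4map_section_sub_mem_range_hurewicz [PathConnectedSpace M]
    (hc : Continuous fun p : SU2 × M => p.1 • p.2) {s₁ s₂ : C(S4, TotalSpace M)}
    (h₁ : IsSection s₁) (h₂ : IsSection s₂) (v : UnitH2) (m : M) :
    H4map s₂ fundamentalClass - H4map s₁ fundamentalClass ∈
      Set.range (fun α : π_ 4 M m => hurewicz (pi4map (fiberIncl v) m α)) := by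
  obtain ⟨f₁, y₁, hf₁, hy₁, hb₁⟩ := exists_section_coordinate hc h₁
  obtain ⟨f₂, y₂, hf₂, hy₂, hb₂⟩ := exists_section_coordinate hc h₂
  obtain ⟨γ⟩ := PathConnectedSpace.joined y₁ y₂
  obtain ⟨k₁, hk₁, _, e₁⟩ := exists_section_coordinate_of_joined hc γ hf₁ hy₁ hb₁
  -- The second section already has the point `y₂`; the constant path only puts its class in the
  -- same form.
  obtain ⟨k₂, hk₂, _, e₂⟩ := exists_section_coordinate_of_joined hc (Path.refl y₂) hf₂ hy₂ hb₂
  rw [e₁, e₂, differenceClass_sub]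
  exact differenceClass_mem_range_hurewicz cubeLift k₂ k₁
    (fun t ht => (hk₂ t ht).trans (hk₁ t ht).symm) _ v m

end SU2Bundle

end

theorem mainTheorem6 {n : ℕ} {M : Type} [TopologicalSpace M]
    [ChartedSpace (EuclideanSpace ℝ (Fin n)) M] [IsManifold (𝓡 n) ∞ M]
    [MulAction SU2Bundle.SU2 M]
    (hφ : ContMDiff ((𝓡 3).prod (𝓡 n)) (𝓡 n) ∞ (fun p : SU2Bundle.SU2 × M => p.1 • p.2)) :
    ((∃ s : C(SU2Bundle.S4, SU2Bundle.TotalSpace M),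
        SU2Bundle.IsSection s ∧ SU2Bundle.IsEquivariant s) ↔
      ∃ x : M, ∀ g : SU2Bundle.SU2, g • x = x) ∧
    (ConnectedSpace M →
      ∀ s₁ s₂ : C(SU2Bundle.S4, SU2Bundle.TotalSpace M),
        SU2Bundle.IsSection s₁ → SU2Bundle.IsSection s₂ →
        ∀ (v : SU2Bundle.UnitH2) (m : M),
          SU2Bundle.H4map s₂ SU2Bundle.fundamentalClass -
              SU2Bundle.H4map s₁ SU2Bundle.fundamentalClass ∈
            Set.range (fun α : π_ 4 M m =>
              SU2Bundle.hurewicz (SU2Bundle.pi4map (SU2Bundle.fiberIncl v) m α))) := by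
  refine ⟨SU2Bundle.exists_equivariant_section_iff, fun hM s₁ s₂ h₁ h₂ v m => ?_⟩
  have : LocallyPathConnectedSpace M :=
    ChartedSpace.locallyPathConnectedSpace (EuclideanSpace ℝ (Fin n)) M
  have : PathConnectedSpace M := pathConnectedSpace_iff_connectedSpace.2 hM
  exact SU2Bundle.H4map_section_sub_mem_range_hurewicz hφ.continuous h₁ h₂ v m
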